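/- Let $O\subset\mathbb{R}^2$ be an open convex polygon with $n\ge 3$ vertices, let $F=\mathbb{R}^2\setminus O$ be the free space, and for each edge $e_i$ let $H_i\subseteq F$ be the closed half plane bounded by the line through $e_i$ on the side away from $O$. Points $x,y\in F$ see each other if $\overline{xy}\cap O=\emptyset$. A watchman route is a continuous map $f:[0,1]\to F$ such that every point of $F$ is seen from some point $f(t)$. Given $s\in F$, an optimal watchman route from $s$ is a watchman route with $f(0)=s$ that has minimal length among all watchman routes starting at $s$. The route $f$ makes a reflection off $H_i$ if at some time it runs along a straight segment from a point outside $H_i$ to a point $p$ on the boundary line of $H_i$ and then (possibly after resting at $p$) along a straight segment from $p$ to a point outside $H_i$, such that the angle of incidence and the angle of return with respect to the boundary line of $H_i$ are equal, in the sense of specular reflection (perpendicular incidence with return along the same line is included). Reflections that occur at different times of arrival, or off different half planes, are counted separately. Then, for every $s\in F$, every optimal watchman route from $s$ makes at most one reflection. Moreover, for every watchman route $f$ starting at $s$ that makes two or more reflections there is a watchman route starting at $s$ that is strictly shorter than $f$. -/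

import Mathlib

open Set

/-- The Euclidean plane. -/
abbrev Plane : Type := EuclideanSpace ℝ (Fin 2)

/-- The planar cross product; `cross u w > 0` iff `w` points strictly to the left of `u`. -/
def cross (u w : Plane) : ℝ := u 0 * w 1 - u 1 * w 0

/-- A (nondegenerate) convex polygon with `n ≥ 3` vertices listed counterclockwise: all vertices
other than the two endpoints of an edge lie strictly to the left of that edge. The index `i + 1` is
taken cyclically in `Fin n`; edge number `i` joins vertex `i` to vertex `i + 1`. -/
structure ConvexPolygon (n : ℕ) [NeZero n] where
  three_le : 3 ≤ n
  vertex : Fin n → Plane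
  left_of_edge : ∀ i j : Fin n, j ≠ i → j ≠ i + 1 →
    0 < cross (vertex (i + 1) - vertex i) (vertex j - vertex i)

/-- The length of a path parametrised by `[0, 1]`. -/
noncomputable def pathLength (f : ℝ → Plane) : ENNReal := eVariationOn f (Icc 0 1)

/-- On the time interval `[a, b]` the path `f` runs monotonically along the straight segment from
`f a` to `f b`. -/
def RunsStraight (f : ℝ → Plane) (a b : ℝ) : Prop :=
  ∃ φ : ℝ → ℝ, MonotoneOn φ (Icc a b) ∧ φ a = 0 ∧ φ b = 1 ∧
    ∀ t ∈ Icc a b, f t = AffineMap.lineMap (f a) (f b) (φ t)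

namespace ConvexPolygon

variable {n : ℕ} [NeZero n]

/-- The obstacle: the open polygon. -/
def obstacle (O : ConvexPolygon n) : Set Plane := interior (convexHull ℝ (range O.vertex))

/-- The free space `F`. -/
def freeSpace (O : ConvexPolygon n) : Set Plane := O.obstacleᶜ

/-- Two points see each other iff the segment between them misses the open obstacle. -/
def Visible (O : ConvexPolygon n) (x y : Plane) : Prop := segment ℝ x y ∩ O.obstacle = ∅

/-- The part of the free space that is seen from some point of `S`. -/
def visibleSet (O : ConvexPolygon n) (S : Set Plane) : Set Plane :=
  {x ∈ O.freeSpace | ∃ y ∈ S, O.Visible x y}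

/-- A path in the free space, parametrised by `[0, 1]`; values outside `[0, 1]` are irrelevant. -/
def IsPath (O : ConvexPolygon n) (f : ℝ → Plane) : Prop :=
  ContinuousOn f (Icc 0 1) ∧ MapsTo f (Icc 0 1) O.freeSpace

/-- A watchman route: a path from which the whole free space is seen. -/
def IsWatchmanRoute (O : ConvexPolygon n) (f : ℝ → Plane) : Prop :=
  O.IsPath f ∧ O.visibleSet (f '' Icc 0 1) = O.freeSpace

/-- A shortest one among all watchman routes starting at `s`. -/
def IsOptimalWatchmanRoute (O : ConvexPolygon n) (s : Plane) (f : ℝ → Plane) : Prop :=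
  O.IsWatchmanRoute f ∧ f 0 = s ∧
    ∀ g : ℝ → Plane, O.IsWatchmanRoute g → g 0 = s → pathLength f ≤ pathLength g

/-- The direction of edge `i`. -/
def edgeDir (O : ConvexPolygon n) (i : Fin n) : Plane := O.vertex (i + 1) - O.vertex i

/-- The closed half plane `H i` bounded by the line of edge `i`, on the side away from the
obstacle. -/
def halfPlane (O : ConvexPolygon n) (i : Fin n) : Set Plane :=
  {x | cross (O.edgeDir i) (x - O.vertex i) ≤ 0}

/-- The line through edge `i`, i.e. the boundary of `H i`. -/
def edgeLine (O : ConvexPolygon n) (i : Fin n) : Set Plane :=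
  {x | cross (O.edgeDir i) (x - O.vertex i) = 0}

/-- At time `t` the path `f` makes a reflection off `H i`: it comes straight from a point `f a`
outside `H i`, arrives at time `t` at a point `f t` of the boundary line of `H i`, possibly rests
there until time `v`, and then goes straight to a point `f b` outside `H i`, and the angle of
incidence with the line equals the angle of return. The two angles are measured against opposite
directions of the line, as in specular reflection. The time `t` is that of the arrival, so that a
rest at `f t` does not count as several reflections. -/
def IsReflection (O : ConvexPolygon n) (f : ℝ → Plane) (i : Fin n) (t : ℝ) : Prop :=
  ∃ a v b : ℝ, 0 ≤ a ∧ a < t ∧ t ≤ v ∧ v < b ∧ b ≤ 1 ∧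
    f a ∉ O.halfPlane i ∧ f t ∈ O.edgeLine i ∧ f b ∉ O.halfPlane i ∧
    RunsStraight f a t ∧ (∀ r ∈ Ico a t, f r ≠ f t) ∧
    (∀ r ∈ Icc t v, f r = f t) ∧ RunsStraight f v b ∧
    InnerProductGeometry.angle (f a - f t) (O.edgeDir i) =
      InnerProductGeometry.angle (f b - f t) (-O.edgeDir i)

/-- All reflections made by `f`, each recorded as the half plane and the time. -/
def reflections (O : ConvexPolygon n) (f : ℝ → Plane) : Set (Fin n × ℝ) :=
  {p | O.IsReflection f p.1 p.2}

end ConvexPolygon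

/-!
A path is a watchman route iff it visits every half plane `H i`: the midpoint of edge `i` is seen
from the points of `H i` only, and conversely any two points of `H i` see each other.

At a reflection off `H i` the path makes a symmetric bend at a point of the edge line. Since the
path is outside `H i` on both sides of the bend, it stays in one other half plane, and at most one
other edge line passes through the bend point. Moving the bend point off the line of edge `i` into
that half plane therefore gives a strictly shorter path in the free space, which loses at most the
visit to `H i`. So a route that cannot be shortened is in `H i` only at the reflection point.

Suppose that such a route reflects off `H i` and later off `H j`, at points `p` and `q`. The line
through two edge midpoints runs inside the obstacle between them, so the route, which meets the two
edge lines only at `p` and `q`, never crosses the line through the midpoints of edges `i` and `j`,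
and does not cross the one through the midpoints of edges `i` and `k` before it visits `H k`. If it
visited `H k` only after reaching `q`, the sides of these lines on which `p` lies would contradict
each other. Hence every `H k` is visited by the time the route reaches `q`, and the route could
have stopped there.
-/
/-! ### Paths -/

section Paths

variable {ι α : Type*} [LinearOrder ι]

/-- The concatenation at time `c` of two paths: `f` up to and including time `c`, and `g`
afterwards. It is used for paths with `f c = g c`. -/
def concatAt (c : ι) (f g : ι → α) : ι → α := fun r => if r ≤ c then f r else g r

/-- The map `f` is, during the closed time interval from `a` to `b`, a continuous path in `S`; its
values at other times are irrelevant. -/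
def IsPathIn [TopologicalSpace ι] [TopologicalSpace α] (S : Set α) (a b : ι) (f : ι → α) : Prop :=
  ContinuousOn f (Icc a b) ∧ MapsTo f (Icc a b) S

lemma concatAt_of_le {f g : ι → α} {c r : ι} (hr : r ≤ c) : concatAt c f g r = f r := if_pos hr

lemma concatAt_of_ge {f g : ι → α} {c r : ι} (hc : f c = g c) (hr : c ≤ r) :
    concatAt c f g r = g r := by
  rcases hr.eq_or_lt with rfl | hr
  · exact (concatAt_of_le le_rfl).trans hc
  · exact if_neg hr.not_ge

lemma eVariationOn_Icc_add_Icc [PseudoEMetricSpace α] (f : ι → α) {a c b : ι} (hac : a ≤ c)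
    (hcb : c ≤ b) :
    eVariationOn f (Icc a c) + eVariationOn f (Icc c b) = eVariationOn f (Icc a b) := by
  simpa only [univ_inter] using eVariationOn.Icc_add_Icc f (s := univ) hac hcb (mem_univ c)

lemma eVariationOn_concatAt [PseudoEMetricSpace α] {f g : ι → α} {a c b : ι} (hac : a ≤ c)
    (hcb : c ≤ b) (hc : f c = g c) :
    eVariationOn (concatAt c f g) (Icc a b) =
      eVariationOn f (Icc a c) + eVariationOn g (Icc c b) := by
  have hf : EqOn (concatAt c f g) f (Icc a c) := fun _ hr => concatAt_of_le hr.2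
  have hg : EqOn (concatAt c f g) g (Icc c b) := fun _ hr => concatAt_of_ge hc hr.1
  rw [← eVariationOn_Icc_add_Icc _ hac hcb, eVariationOn.eq_of_eqOn hf, eVariationOn.eq_of_eqOn hg]

lemma edist_add_edist_le_eVariationOn [PseudoEMetricSpace α] (f : ι → α) {a c b : ι} (hac : a ≤ c)
    (hcb : c ≤ b) : edist (f a) (f c) + edist (f c) (f b) ≤ eVariationOn f (Icc a b) := by
  rw [← eVariationOn_Icc_add_Icc f hac hcb]
  exact add_le_add (eVariationOn.edist_le f (left_mem_Icc.2 hac) (right_mem_Icc.2 hac))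
    (eVariationOn.edist_le f (left_mem_Icc.2 hcb) (right_mem_Icc.2 hcb))

namespace IsPathIn

variable [TopologicalSpace ι] [TopologicalSpace α] {S : Set α} {f g : ι → α} {a b c d : ι}

lemma mono (hf : IsPathIn S a b f) (hac : a ≤ c) (hdb : d ≤ b) : IsPathIn S c d f :=
  ⟨hf.1.mono (Icc_subset_Icc hac hdb), hf.2.mono_left (Icc_subset_Icc hac hdb)⟩

lemma concat [OrderClosedTopology ι] (hf : IsPathIn S a c f) (hg : IsPathIn S c b g)
    (hac : a ≤ c) (hcb : c ≤ b) (hc : f c = g c) : IsPathIn S a b (concatAt c f g) := by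
  have hf' : EqOn (concatAt c f g) f (Icc a c) := fun _ hr => concatAt_of_le hr.2
  have hg' : EqOn (concatAt c f g) g (Icc c b) := fun _ hr => concatAt_of_ge hc hr.1
  rw [IsPathIn, ← Icc_union_Icc_eq_Icc hac hcb]
  exact ⟨(hf.1.congr hf').union_of_isClosed (hg.1.congr hg') isClosed_Icc isClosed_Icc,
    (hf.2.congr hf'.symm).union (hg.2.congr hg'.symm)⟩

end IsPathIn

end Paths

section Rescaling

variable {α : Type*} {T : ℝ}

lemma image_mul_Icc_zero_one (hT : 0 ≤ T) : (fun u : ℝ => T * u) '' Icc 0 1 = Icc 0 T := by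
  rw [image_mul_left_Icc hT zero_le_one, mul_zero, mul_one]

lemma eVariationOn_comp_mul [PseudoEMetricSpace α] (f : ℝ → α) (hT : 0 ≤ T) :
    eVariationOn (fun u => f (T * u)) (Icc 0 1) = eVariationOn f (Icc 0 T) := by
  rw [← image_mul_Icc_zero_one hT]
  exact eVariationOn.comp_eq_of_monotoneOn f _ ((monotone_mul_left_of_nonneg hT).monotoneOn _)

lemma IsPathIn.comp_mul [TopologicalSpace α] {S : Set α} {f : ℝ → α} (hf : IsPathIn S 0 T f)
    (hT : 0 ≤ T) : IsPathIn S 0 1 fun u => f (T * u) := by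
  have hmaps : MapsTo (fun u : ℝ => T * u) (Icc 0 1) (Icc 0 T) :=
    mapsTo_iff_image_subset.2 (image_mul_Icc_zero_one hT).subset
  exact ⟨hf.1.comp (by fun_prop) hmaps, hf.2.comp hmaps⟩

end Rescaling

section PolygonalPaths

variable {E : Type*} [SeminormedAddCommGroup E] [NormedSpace ℝ E] {S : Set E} {c d : ℝ}

/-- The path that runs along the segment from `A` to `B` at constant speed during `[c, d]`. -/
noncomputable def segmentPath (A B : E) (c d : ℝ) : ℝ → E :=
  fun r => AffineMap.lineMap A B ((r - c) / (d - c))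

@[simp] lemma segmentPath_left (A B : E) (c d : ℝ) : segmentPath A B c d c = A := by
  simp [segmentPath]

lemma segmentPath_right (A B : E) (hcd : c < d) : segmentPath A B c d d = B := by
  simp [segmentPath, div_self (sub_pos.2 hcd).ne']

lemma isPathIn_segmentPath {A B : E} (hS : segment ℝ A B ⊆ S) (hcd : c ≤ d) :
    IsPathIn S c d (segmentPath A B c d) := by
  refine ⟨by unfold segmentPath; fun_prop, fun r hr => hS ?_⟩
  rw [segment_eq_image_lineMap]
  exact mem_image_of_mem _ ⟨div_nonneg (sub_nonneg.2 hr.1) (sub_nonneg.2 hcd),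
    div_le_one_of_le₀ (sub_le_sub_right hr.2 c) (sub_nonneg.2 hcd)⟩

lemma eVariationOn_segmentPath_le (A B : E) (hcd : c ≤ d) :
    eVariationOn (segmentPath A B c d) (Icc c d) ≤ edist A B := by
  have hmono : MonotoneOn (fun r => (r - c) / (d - c)) (Icc c d) := fun _ _ _ _ hxy =>
    div_le_div_of_nonneg_right (sub_le_sub_right hxy c) (sub_nonneg.2 hcd)
  have hvar := hmono.eVariationOn_eq (left_mem_Icc.2 hcd) (right_mem_Icc.2 hcd)
  rw [inter_self, sub_self, zero_div, sub_zero] at hvar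
  calc eVariationOn (segmentPath A B c d) (Icc c d)
      ≤ nndist A B * eVariationOn (fun r => (r - c) / (d - c)) (Icc c d) :=
        (lipschitzWith_lineMap A B).lipschitzOnWith.comp_eVariationOn_le (mapsTo_univ _ _)
    _ ≤ nndist A B * 1 := by
        gcongr
        rw [hvar]
        exact ENNReal.ofReal_le_one.2 (div_self_le_one _)
    _ = edist A B := by rw [mul_one, edist_nndist]

lemma exists_isPathIn_through {A q B : E} (hAq : segment ℝ A q ⊆ S) (hqB : segment ℝ q B ⊆ S)
    (hcd : c < d) :
    ∃ g, IsPathIn S c d g ∧ g c = A ∧ g d = B ∧ q ∈ g '' Icc c d ∧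
      eVariationOn g (Icc c d) ≤ edist A q + edist q B := by
  obtain ⟨m, hcm, hmd⟩ := exists_between hcd
  have hm : segmentPath A q c m m = segmentPath q B m d m := by
    rw [segmentPath_right _ _ hcm, segmentPath_left]
  refine ⟨concatAt m (segmentPath A q c m) (segmentPath q B m d),
    (isPathIn_segmentPath hAq hcm.le).concat (isPathIn_segmentPath hqB hmd.le) hcm.le hmd.le hm,
    ?_, ?_, ⟨m, ⟨hcm.le, hmd.le⟩, ?_⟩, ?_⟩
  · rw [concatAt_of_le hcm.le, segmentPath_left]
  · rw [concatAt_of_ge hm hmd.le, segmentPath_right _ _ hmd]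
  · rw [concatAt_of_le le_rfl, segmentPath_right _ _ hcm]
  · rw [eVariationOn_concatAt hcm.le hmd.le hm]
    exact add_le_add (eVariationOn_segmentPath_le _ _ hcm.le)
      (eVariationOn_segmentPath_le _ _ hmd.le)

lemma IsPathIn.exists_shortcut {f : ℝ → E} {a b τ : ℝ} {q : E} (hf : IsPathIn S a b f)
    (hfin : eVariationOn f (Icc a b) ≠ ⊤) (hac : a ≤ c) (hcτ : c < τ) (hτd : τ < d) (hdb : d ≤ b)
    (hcq : segment ℝ (f c) q ⊆ S) (hqd : segment ℝ q (f d) ⊆ S)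
    (hlt : dist (f c) q + dist q (f d) < dist (f c) (f τ) + dist (f τ) (f d)) :
    ∃ g, IsPathIn S a b g ∧ (∀ r, r ∉ Ioo c d → g r = f r) ∧ q ∈ g '' Icc a b ∧
      eVariationOn g (Icc a b) < eVariationOn f (Icc a b) := by
  have hcd := hcτ.trans hτd
  obtain ⟨g, hg, hgc, hgd, ⟨m, hm, rfl⟩, hglen⟩ := exists_isPathIn_through hcq hqd hcd
  have hc : f c = concatAt d g f c := by rw [concatAt_of_le hcd.le, hgc]
  refine ⟨concatAt c f (concatAt d g f), (hf.mono le_rfl (hcd.le.trans hdb)).concat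
    (hg.concat (hf.mono (hac.trans hcd.le) le_rfl) hcd.le hdb hgd) hac (hcd.le.trans hdb) hc,
    fun r hr => ?_, ⟨m, ⟨hac.trans hm.1, hm.2.trans hdb⟩, ?_⟩, ?_⟩
  · rcases le_or_gt r c with hrc | hcr
    · exact concatAt_of_le hrc
    · have hdr : d ≤ r := not_lt.1 fun hrd => hr ⟨hcr, hrd⟩
      rw [concatAt_of_ge hc hcr.le, concatAt_of_ge hgd hdr]
  · rw [concatAt_of_ge hc hm.1, concatAt_of_le hm.2]
  · have hlt' : eVariationOn g (Icc c d) < eVariationOn f (Icc c d) := by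
      refine (hglen.trans_lt ?_).trans_le (edist_add_edist_le_eVariationOn f hcτ.le hτd.le)
      simp only [edist_dist, ← ENNReal.ofReal_add dist_nonneg dist_nonneg]
      exact (ENNReal.ofReal_lt_ofReal_iff_of_nonneg (by positivity)).2 hlt
    have hfin_left : eVariationOn f (Icc a c) ≠ ⊤ :=
      ne_top_of_le_ne_top hfin (eVariationOn.mono f (Icc_subset_Icc_right (hcd.le.trans hdb)))
    have hfin_right : eVariationOn f (Icc d b) ≠ ⊤ :=
      ne_top_of_le_ne_top hfin (eVariationOn.mono f (Icc_subset_Icc_left (hac.trans hcd.le)))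
    rw [eVariationOn_concatAt hac (hcd.le.trans hdb) hc, eVariationOn_concatAt hcd.le hdb hgd,
      ← eVariationOn_Icc_add_Icc f hac (hcd.le.trans hdb), ← eVariationOn_Icc_add_Icc f hcd.le hdb]
    exact ENNReal.add_lt_add_left hfin_left (ENNReal.add_lt_add_right hfin_right hlt')

lemma exists_isPathIn_polygonal (v : ℕ → E) (N : ℕ)
    (hv : ∀ k ≤ N, segment ℝ (v k) (v (k + 1)) ⊆ S) :
    ∃ g, IsPathIn S 0 (N : ℝ) g ∧ eVariationOn g (Icc 0 (N : ℝ)) ≠ ⊤ ∧ ∀ k ≤ N, g k = v k := by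
  induction N with
  | zero =>
    refine ⟨fun _ => v 0, ⟨continuousOn_const, fun _ _ => hv 0 le_rfl (left_mem_segment ..)⟩, ?_⟩
    simp
  | succ N ih =>
    obtain ⟨g, hg, hfin, hgv⟩ := ih fun k hk => hv k (hk.trans N.le_succ)
    have hlt : (N : ℝ) < (N + 1 : ℕ) := by exact_mod_cast N.lt_succ_self
    have hN : g N = segmentPath (v N) (v (N + 1)) N (N + 1 : ℕ) N := by
      rw [hgv N le_rfl, segmentPath_left]
    refine ⟨concatAt (N : ℝ) g (segmentPath (v N) (v (N + 1)) N (N + 1 : ℕ)),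
      hg.concat (isPathIn_segmentPath (hv N N.le_succ) hlt.le) N.cast_nonneg hlt.le hN, ?_,
      fun k hk => ?_⟩
    · rw [eVariationOn_concatAt N.cast_nonneg hlt.le hN]
      exact ENNReal.add_ne_top.2 ⟨hfin, ne_top_of_le_ne_top (edist_ne_top _ _)
        (eVariationOn_segmentPath_le _ _ hlt.le)⟩
    · rcases Nat.le_succ_iff.1 hk with hk | rfl
      · rw [concatAt_of_le (by exact_mod_cast hk), hgv k hk]
      · rw [concatAt_of_ge hN hlt.le, segmentPath_right _ _ hlt]

end PolygonalPaths

/-! ### The cross product and orientation -/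

lemma cross_swap (u w : Plane) : cross w u = -cross u w := by
  simp only [cross]
  ring

/-- The cross product with a fixed left factor, as a linear map. -/
def crossLin (u : Plane) : Plane →ₗ[ℝ] ℝ where
  toFun := cross u
  map_add' x y := by simp only [cross, PiLp.add_apply]; ring
  map_smul' c x := by simp only [cross, PiLp.smul_apply, smul_eq_mul, RingHom.id_apply]; ring

lemma cross_add_right (u w z : Plane) : cross u (w + z) = cross u w + cross u z :=
  (crossLin u).map_add w z

lemma cross_smul_right (u w : Plane) (c : ℝ) : cross u (c • w) = c * cross u w :=
  (crossLin u).map_smul c w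

lemma cross_self_eq_zero (u : Plane) : cross u u = 0 := by simp only [cross]; ring

lemma cross_smul_eq_sub (u w z : Plane) : cross u w • z = cross u z • w - cross w z • u := by
  ext m
  fin_cases m <;> simp [cross] <;> ring

lemma inner_mul_inner_self_eq_add (d x y : Plane) :
    inner ℝ x y * inner ℝ d d = cross d x * cross d y + inner ℝ x d * inner ℝ y d := by
  simp only [cross, PiLp.inner_apply, Fin.sum_univ_two, RCLike.inner_apply, conj_trivial]
  ring

lemma exists_eq_smul_of_cross_eq_zero {u w : Plane} (hu : u ≠ 0) (h : cross u w = 0) :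
    ∃ c : ℝ, w = c • u := by
  have hu' : inner ℝ u u ≠ (0 : ℝ) := inner_self_ne_zero.2 hu
  refine ⟨inner ℝ u w / inner ℝ u u, ?_⟩
  have key : inner ℝ u u • w = inner ℝ u w • u := by
    ext m
    simp only [PiLp.inner_apply, Fin.sum_univ_two, cross, RCLike.inner_apply, conj_trivial,
      PiLp.smul_apply, smul_eq_mul] at h ⊢
    fin_cases m <;> dsimp
    · linear_combination (-u 1) * h
    · linear_combination (u 0) * h
  rw [div_eq_inv_mul, mul_smul, ← key, inv_smul_smul₀ hu']

lemma eq_zero_of_inner_eq_zero {u w z : Plane} (huw : cross u w ≠ 0) (hu : inner ℝ z u = 0)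
    (hw : inner ℝ z w = 0) : z = 0 := by
  have h := congrArg (inner ℝ z) (cross_smul_eq_sub u w z)
  rw [inner_sub_right, inner_smul_right, inner_smul_right, inner_smul_right, hu, hw, mul_zero,
    mul_zero, sub_zero] at h
  exact inner_self_eq_zero.1 ((mul_eq_zero.1 h).resolve_left huw)

/-- Twice the signed area of the triangle `p q z` as a function of `z`: positive iff `z` lies
strictly to the left of the directed line from `p` to `q`. -/
def orient (p q : Plane) : Plane →ᵃ[ℝ] ℝ where
  toFun z := cross (q - p) (z - p)
  linear := crossLin (q - p)
  map_vadd' z v := by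
    rw [vadd_eq_add, add_sub_assoc]
    exact cross_add_right (q - p) v (z - p)

lemma orient_left (p q : Plane) : orient p q p = 0 := by
  simp [orient, cross]

lemma orient_right (p q : Plane) : orient p q q = 0 := cross_self_eq_zero _

lemma orient_swap (p q z : Plane) : orient q p z = -orient p q z := by
  simp only [orient, AffineMap.coe_mk, cross, PiLp.sub_apply]
  ring

lemma orient_swap_right (p q z : Plane) : orient p z q = -orient p q z := cross_swap _ _

lemma continuous_orient (p q : Plane) : Continuous (orient p q) :=
  (orient p q).continuous_of_finiteDimensional

lemma orient_add (p q z v : Plane) : orient p q (z + v) = orient p q z + cross (q - p) v := by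
  rw [add_comm z, add_comm (orient p q z)]
  exact (orient p q).map_vadd z v

lemma exists_eq_lineMap_of_orient_eq_zero {p q z : Plane} (hpq : p ≠ q)
    (hz : orient p q z = 0) : ∃ c : ℝ, z = AffineMap.lineMap p q c := by
  obtain ⟨c, hc⟩ := exists_eq_smul_of_cross_eq_zero (sub_ne_zero.2 hpq.symm) hz
  exact ⟨c, by rw [AffineMap.lineMap_apply, vsub_eq_sub, ← hc, vadd_eq_add, sub_add_cancel]⟩

/-! ### Convex polygons -/

namespace ConvexPolygon

variable {n : ℕ} [NeZero n] (O : ConvexPolygon n)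

/-- The affine function that vanishes on the line of edge `i`, is positive on the side of the
polygon and nonpositive exactly on `O.halfPlane i`. -/
def side (i : Fin n) : Plane →ᵃ[ℝ] ℝ := orient (O.vertex i) (O.vertex (i + 1))

/-- The midpoint of edge `i`, which serves as a point of the edge off all the other edge lines. -/
noncomputable def edgeMid (i : Fin n) : Plane := midpoint ℝ (O.vertex i) (O.vertex (i + 1))

lemma mem_halfPlane {i : Fin n} {z : Plane} : z ∈ O.halfPlane i ↔ O.side i z ≤ 0 := Iff.rfl

lemma mem_edgeLine {i : Fin n} {z : Plane} : z ∈ O.edgeLine i ↔ O.side i z = 0 := Iff.rfl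

lemma notMem_halfPlane {i : Fin n} {z : Plane} : z ∉ O.halfPlane i ↔ 0 < O.side i z :=
  not_le (a := O.side i z)

lemma edgeLine_subset_halfPlane (i : Fin n) : O.edgeLine i ⊆ O.halfPlane i :=
  fun _ hz => le_of_eq hz

lemma continuous_side (i : Fin n) : Continuous (O.side i) := continuous_orient _ _

lemma side_add (i : Fin n) (z v : Plane) :
    O.side i (z + v) = O.side i z + cross (O.edgeDir i) v :=
  orient_add _ _ _ _

lemma side_add_smul {i : Fin n} {p : Plane} (hp : p ∈ O.edgeLine i) (c : ℝ) (v : Plane) :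
    O.side i (p + c • v) = c * cross (O.edgeDir i) v := by
  rw [side_add, O.mem_edgeLine.1 hp, cross_smul_right, zero_add]

lemma succ_ne (O : ConvexPolygon n) (i : Fin n) : i + 1 ≠ i := by
  have h := O.three_le
  rw [Ne, add_eq_left, Fin.ext_iff, Fin.val_one', Fin.val_zero, Nat.mod_eq_of_lt (by lia)]
  lia

lemma succ_succ_ne (O : ConvexPolygon n) (i : Fin n) : i + 1 + 1 ≠ i := by
  have h := O.three_le
  rw [Ne, add_assoc, add_eq_left, Fin.ext_iff, Fin.val_add, Fin.val_one', Fin.val_zero,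
    Nat.mod_eq_of_lt (by lia : 1 < n), Nat.mod_eq_of_lt (by lia)]
  lia

lemma side_vertex_pos {i j : Fin n} (h : j ≠ i) (h' : j ≠ i + 1) : 0 < O.side i (O.vertex j) :=
  O.left_of_edge i j h h'

lemma vertex_mem_edgeLine (i : Fin n) : O.vertex i ∈ O.edgeLine i := orient_left _ _

lemma vertex_succ_mem_edgeLine (i : Fin n) : O.vertex (i + 1) ∈ O.edgeLine i := orient_right _ _

lemma side_vertex_nonneg (i j : Fin n) : 0 ≤ O.side i (O.vertex j) := by
  rcases eq_or_ne j i with rfl | h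
  · exact (O.vertex_mem_edgeLine j).ge
  rcases eq_or_ne j (i + 1) with rfl | h'
  · exact (O.vertex_succ_mem_edgeLine i).ge
  · exact (O.side_vertex_pos h h').le

lemma side_edgeMid (i j : Fin n) :
    O.side i (O.edgeMid j) = (O.side i (O.vertex j) + O.side i (O.vertex (j + 1))) / 2 := by
  rw [edgeMid, AffineMap.map_midpoint, midpoint_eq_smul_add, smul_eq_mul, invOf_eq_inv,
    inv_mul_eq_div]

lemma edgeMid_mem_edgeLine (i : Fin n) : O.edgeMid i ∈ O.edgeLine i := by
  rw [mem_edgeLine, side_edgeMid, O.mem_edgeLine.1 (O.vertex_mem_edgeLine i),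
    O.mem_edgeLine.1 (O.vertex_succ_mem_edgeLine i), add_zero, zero_div]

lemma side_edgeMid_pos {i j : Fin n} (hji : j ≠ i) : 0 < O.side i (O.edgeMid j) := by
  rw [side_edgeMid]
  have hj := O.side_vertex_nonneg i j
  have hj' := O.side_vertex_nonneg i (j + 1)
  rcases eq_or_ne j (i + 1) with rfl | h
  · linarith [O.side_vertex_pos (O.succ_succ_ne i) (O.succ_ne (i + 1))]
  · linarith [O.side_vertex_pos hji h]

lemma edgeMid_injective : Function.Injective O.edgeMid := fun i j hij => by
  by_contra hne
  exact (O.side_edgeMid_pos hne).ne' (hij ▸ O.edgeMid_mem_edgeLine j)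

lemma cross_edgeDir_succ_pos (i : Fin n) : 0 < cross (O.edgeDir i) (O.edgeDir (i + 1)) := by
  have h := O.side_vertex_pos (O.succ_succ_ne i) (O.succ_ne (i + 1))
  rwa [← add_sub_cancel (O.vertex (i + 1)) (O.vertex (i + 1 + 1)), side_add,
    O.mem_edgeLine.1 (O.vertex_succ_mem_edgeLine i), zero_add] at h

lemma edgeDir_ne_zero (i : Fin n) : O.edgeDir i ≠ 0 := fun h => by
  have hpos := O.cross_edgeDir_succ_pos i
  simp [h, cross] at hpos

lemma convexHull_range_vertex :
    convexHull ℝ (range O.vertex) = ⋂ i, O.side i ⁻¹' Ici 0 := by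
  refine Subset.antisymm (convexHull_min ?_ ?_) fun y hy => ?_
  · rintro _ ⟨j, rfl⟩
    exact mem_iInter.2 fun i => O.side_vertex_nonneg i j
  · exact convex_iInter fun i => (convex_Ici 0).affine_preimage _
  -- A separating functional is maximal at some vertex, and at that vertex `y` lies in the cone
  -- spanned by the two edges.
  · by_contra hnot
    obtain ⟨l, c, hl, hc⟩ := geometric_hahn_banach_closed_point (convex_convexHull ℝ _)
      ((finite_range O.vertex).isClosed_convexHull ℝ) hnot
    obtain ⟨k, hk⟩ := Finite.exists_max fun j => l (O.vertex j)
    obtain ⟨i, rfl⟩ : ∃ i : Fin n, k = i + 1 := ⟨k - 1, (sub_add_cancel k 1).symm⟩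
    have hside : O.side i y = cross (O.edgeDir i) (y - O.vertex (i + 1)) := by
      rw [← add_sub_cancel (O.vertex (i + 1)) y, side_add, add_sub_cancel,
        O.mem_edgeLine.1 (O.vertex_succ_mem_edgeLine i), zero_add]
    have hcone := congrArg l
      (cross_smul_eq_sub (O.edgeDir i) (O.edgeDir (i + 1)) (y - O.vertex (i + 1)))
    rw [← hside, show cross (O.edgeDir (i + 1)) (y - O.vertex (i + 1)) = O.side (i + 1) y from rfl]
      at hcone
    simp only [map_smul, map_sub, smul_eq_mul, edgeDir] at hcone
    have hlt : 0 < l y - l (O.vertex (i + 1)) :=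
      sub_pos.2 ((hl _ (subset_convexHull ℝ _ (mem_range_self _))).trans hc)
    have hprev : 0 ≤ O.side (i + 1) y * (l (O.vertex (i + 1)) - l (O.vertex i)) :=
      mul_nonneg (mem_iInter.1 hy (i + 1)) (sub_nonneg.2 (hk i))
    have hnext : 0 ≤ O.side i y * (l (O.vertex (i + 1)) - l (O.vertex (i + 1 + 1))) :=
      mul_nonneg (mem_iInter.1 hy i) (sub_nonneg.2 (hk _))
    have hpos := mul_pos (O.cross_edgeDir_succ_pos i) hlt
    simp only [edgeDir] at hpos
    linarith

lemma isOpenMap_side (i : Fin n) : IsOpenMap (O.side i) := by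
  have hsurj : Function.Surjective (crossLin (O.edgeDir i)) :=
    LinearMap.surjective fun h => (O.cross_edgeDir_succ_pos i).ne' (LinearMap.congr_fun h _)
  exact (AffineMap.isOpenMap_linear_iff (f := O.side i)).1
    (LinearMap.isOpenMap_of_finiteDimensional _ hsurj)

lemma obstacle_eq_iInter : O.obstacle = ⋂ i, O.side i ⁻¹' Ioi 0 := by
  rw [obstacle, convexHull_range_vertex, interior_iInter_of_finite]
  refine iInter_congr fun i => ?_
  rw [← (O.isOpenMap_side i).preimage_interior_eq_interior_preimage (O.continuous_side i),
    interior_Ici]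

lemma mem_obstacle {z : Plane} : z ∈ O.obstacle ↔ ∀ i, 0 < O.side i z := by
  rw [obstacle_eq_iInter, mem_iInter]
  exact Iff.rfl

lemma mem_freeSpace {z : Plane} : z ∈ O.freeSpace ↔ ∃ i, z ∈ O.halfPlane i := by
  rw [freeSpace, mem_compl_iff, mem_obstacle, not_forall]
  exact exists_congr fun _ => not_lt

lemma halfPlane_subset_freeSpace (i : Fin n) : O.halfPlane i ⊆ O.freeSpace := fun _ hz =>
  O.mem_freeSpace.2 ⟨i, hz⟩

lemma convex_halfPlane (i : Fin n) : Convex ℝ (O.halfPlane i) :=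
  (convex_Iic (0 : ℝ)).affine_preimage (O.side i)

lemma segment_subset_freeSpace {i : Fin n} {x y : Plane} (hx : x ∈ O.halfPlane i)
    (hy : y ∈ O.halfPlane i) : segment ℝ x y ⊆ O.freeSpace :=
  ((O.convex_halfPlane i).segment_subset hx hy).trans (O.halfPlane_subset_freeSpace i)

lemma visible_of_mem_halfPlane {i : Fin n} {x y : Plane} (hx : x ∈ O.halfPlane i)
    (hy : y ∈ O.halfPlane i) : O.Visible x y :=
  (disjoint_left.2 fun _ hz => O.segment_subset_freeSpace hx hy hz).inter_eq

lemma mem_halfPlane_of_visible_edgeMid {i : Fin n} {y : Plane}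
    (hy : O.Visible (O.edgeMid i) y) : y ∈ O.halfPlane i := by
  by_contra hyi
  rw [notMem_halfPlane] at hyi
  have hev : ∀ᶠ e : ℝ in nhdsWithin 0 (Ioi 0),
      ∀ j, 0 < O.side j (AffineMap.lineMap (O.edgeMid i) y e) := by
    refine Filter.eventually_all.2 fun j => ?_
    rcases eq_or_ne i j with rfl | hij
    · filter_upwards [self_mem_nhdsWithin] with e he
      rw [AffineMap.apply_lineMap, O.mem_edgeLine.1 (O.edgeMid_mem_edgeLine i),
        AffineMap.lineMap_apply_ring', sub_zero, add_zero]
      exact mul_pos he hyi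
    · have hc : Continuous fun e : ℝ => O.side j (AffineMap.lineMap (O.edgeMid i) y e) :=
        (O.continuous_side j).comp AffineMap.lineMap_continuous
      refine (hc.tendsto' 0 _ rfl).eventually (lt_mem_nhds ?_) |>.filter_mono nhdsWithin_le_nhds
      rw [AffineMap.lineMap_apply_zero]
      exact O.side_edgeMid_pos hij
  obtain ⟨e, he, he01⟩ := (hev.and (Ioo_mem_nhdsGT (zero_lt_one' ℝ))).exists
  refine (eq_empty_iff_forall_notMem.1 hy) _ ⟨?_, O.mem_obstacle.2 he⟩
  rw [segment_eq_image_lineMap]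
  exact mem_image_of_mem _ (Ioo_subset_Icc_self he01)

lemma isWatchmanRoute_iff {f : ℝ → Plane} :
    O.IsWatchmanRoute f ↔ O.IsPath f ∧ ∀ i, ∃ t ∈ Icc (0 : ℝ) 1, f t ∈ O.halfPlane i := by
  refine and_congr_right fun _ => ⟨fun hv i => ?_, fun hv => ?_⟩
  · have hi : O.edgeMid i ∈ O.freeSpace :=
      O.halfPlane_subset_freeSpace i (O.edgeLine_subset_halfPlane i (O.edgeMid_mem_edgeLine i))
    rw [← hv] at hi
    obtain ⟨-, _, ⟨t, ht, rfl⟩, hvis⟩ := hi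
    exact ⟨t, ht, O.mem_halfPlane_of_visible_edgeMid hvis⟩
  · refine Subset.antisymm (sep_subset _ _) fun x hx => ⟨hx, ?_⟩
    obtain ⟨i, hi⟩ := O.mem_freeSpace.1 hx
    obtain ⟨t, ht, hti⟩ := hv i
    exact ⟨f t, mem_image_of_mem f ht, O.visible_of_mem_halfPlane hi hti⟩

end ConvexPolygon

/-! ### Edge lines through a common point -/

namespace ConvexPolygon

variable {n : ℕ} [NeZero n] (O : ConvexPolygon n) {i j k : Fin n} {p : Plane}

lemma edgeMid_add_smul_mem_edgeLine (i : Fin n) (c : ℝ) :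
    O.edgeMid i + c • O.edgeDir i ∈ O.edgeLine i := by
  rw [mem_edgeLine, O.side_add_smul (O.edgeMid_mem_edgeLine i), cross_self_eq_zero, mul_zero]

lemma exists_eq_edgeMid_add_smul (hp : p ∈ O.edgeLine i) :
    ∃ c : ℝ, p = O.edgeMid i + c • O.edgeDir i := by
  have h : O.side i p = cross (O.edgeDir i) (p - O.edgeMid i) := by
    rw [← add_sub_cancel (O.edgeMid i) p, side_add, add_sub_cancel,
      O.mem_edgeLine.1 (O.edgeMid_mem_edgeLine i), zero_add]
  obtain ⟨c, hc⟩ := exists_eq_smul_of_cross_eq_zero (O.edgeDir_ne_zero i)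
    (h.symm.trans (O.mem_edgeLine.1 hp))
  exact ⟨c, sub_eq_iff_eq_add'.1 hc⟩

lemma mul_cross_edgeDir_neg (hij : i ≠ j) {c : ℝ}
    (hi : O.edgeMid j + c • O.edgeDir j ∈ O.edgeLine i) :
    c * cross (O.edgeDir i) (O.edgeDir j) < 0 := by
  have h := O.side_edgeMid_pos hij.symm
  rw [← add_neg_cancel_right (O.edgeMid j) (c • O.edgeDir j), ← neg_smul,
    O.side_add_smul hi] at h
  linarith

lemma cross_edgeDir_ne_zero (hij : i ≠ j) (hi : p ∈ O.edgeLine i) (hj : p ∈ O.edgeLine j) :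
    cross (O.edgeDir i) (O.edgeDir j) ≠ 0 := by
  obtain ⟨c, rfl⟩ := O.exists_eq_edgeMid_add_smul hj
  exact right_ne_zero_of_mul (O.mul_cross_edgeDir_neg hij hi).ne

lemma mul_neg_of_edgeMid_add_smul_eq (hij : i ≠ j) {c e : ℝ}
    (hi : p = O.edgeMid i + c • O.edgeDir i) (hj : p = O.edgeMid j + e • O.edgeDir j) :
    c * e < 0 := by
  have hc := O.mul_cross_edgeDir_neg hij.symm
    (hi.symm.trans hj ▸ O.edgeMid_add_smul_mem_edgeLine j e)
  have he := O.mul_cross_edgeDir_neg hij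
    (hj.symm.trans hi ▸ O.edgeMid_add_smul_mem_edgeLine i c)
  rw [cross_swap] at hc
  by_contra! hce
  nlinarith [mul_pos_of_neg_of_neg hc he, sq_nonneg (cross (O.edgeDir i) (O.edgeDir j)),
    mul_nonneg hce (sq_nonneg (cross (O.edgeDir i) (O.edgeDir j)))]

-- From the common point, any two of the three edges would lie in opposite directions along
-- their lines.
lemma notMem_edgeLine_of_mem_of_mem (hij : i ≠ j) (hik : i ≠ k) (hjk : j ≠ k)
    (hi : p ∈ O.edgeLine i) (hj : p ∈ O.edgeLine j) : p ∉ O.edgeLine k := by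
  intro hk
  obtain ⟨a, ha⟩ := O.exists_eq_edgeMid_add_smul hi
  obtain ⟨b, hb⟩ := O.exists_eq_edgeMid_add_smul hj
  obtain ⟨c, hc⟩ := O.exists_eq_edgeMid_add_smul hk
  have hab := O.mul_neg_of_edgeMid_add_smul_eq hij ha hb
  have hac := O.mul_neg_of_edgeMid_add_smul_eq hik ha hc
  have hbc := O.mul_neg_of_edgeMid_add_smul_eq hjk hb hc
  have hneg : (a * b) * (a * c) * (b * c) < 0 :=
    mul_neg_of_pos_of_neg (mul_pos_of_neg_of_neg hab hac) hbc
  linarith [sq_nonneg (a * b * c)]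

/-- The open star of `p` in the arrangement of the edge lines: the points that lie strictly on the
same side as `p` of every edge line not containing `p`. -/
def openStar (p : Plane) : Set Plane :=
  {z | ∀ j, (0 < O.side j p → 0 < O.side j z) ∧ (O.side j p < 0 → O.side j z < 0)}

lemma openStar_mem_nhds (p : Plane) : O.openStar p ∈ nhds p := by
  refine Filter.eventually_all.2 fun j => ?_
  have hside := (O.continuous_side j).tendsto p
  refine Filter.Eventually.and ?_ ?_ <;> rw [Filter.eventually_imp_distrib_left]
  · exact fun h => hside.eventually (lt_mem_nhds h)
  · exact fun h => hside.eventually (gt_mem_nhds h)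

variable {O}

lemma mem_halfPlane_of_mem_openStar {z : Plane} (hz : z ∈ O.openStar p) (hj : z ∈ O.halfPlane j) :
    p ∈ O.halfPlane j := by
  by_contra hp
  exact O.notMem_halfPlane.2 ((hz j).1 (O.notMem_halfPlane.1 hp)) hj

variable (O)

lemma exists_common_halfPlane {u w : Plane} (hp : p ∈ O.edgeLine i)
    (hu : u ∈ O.openStar p ∩ O.freeSpace) (hw : w ∈ O.openStar p ∩ O.freeSpace)
    (hui : u ∉ O.halfPlane i) (hwi : w ∉ O.halfPlane i) :
    ∃ j ≠ i, p ∈ O.halfPlane j ∧ u ∈ O.halfPlane j ∧ w ∈ O.halfPlane j := by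
  obtain ⟨k, huk⟩ := O.mem_freeSpace.1 hu.2
  obtain ⟨l, hwl⟩ := O.mem_freeSpace.1 hw.2
  have hki : k ≠ i := fun h => hui (h ▸ huk)
  have hli : l ≠ i := fun h => hwi (h ▸ hwl)
  have hpk := mem_halfPlane_of_mem_openStar hu.1 huk
  have hpl := mem_halfPlane_of_mem_openStar hw.1 hwl
  rcases (O.mem_halfPlane.1 hpk).lt_or_eq with hk | hk
  · exact ⟨k, hki, hpk, huk, ((hw.1 k).2 hk).le⟩
  rcases (O.mem_halfPlane.1 hpl).lt_or_eq with hl | hl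
  · exact ⟨l, hli, hpl, ((hu.1 l).2 hl).le, hwl⟩
  · obtain rfl : k = l := by
      by_contra hkl
      exact O.notMem_edgeLine_of_mem_of_mem hki.symm hli.symm hkl hp hk hl
    exact ⟨k, hki, hpk, huk, hwl⟩

lemma exists_cross_pos_and_cross_neg (hp : p ∈ O.edgeLine i) :
    ∃ m, 0 < cross (O.edgeDir i) m ∧ ∀ j ≠ i, p ∈ O.edgeLine j → cross (O.edgeDir j) m < 0 := by
  by_cases h : ∃ j ≠ i, p ∈ O.edgeLine j
  · obtain ⟨j, hji, hj⟩ := h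
    have hsq := sq_pos_of_ne_zero (O.cross_edgeDir_ne_zero hji.symm hp hj)
    refine ⟨cross (O.edgeDir i) (O.edgeDir j) • (O.edgeDir i + O.edgeDir j), ?_, fun k hki hk => ?_⟩
    · rw [cross_smul_right, cross_add_right, cross_self_eq_zero]
      linarith
    · obtain rfl : k = j := by
        by_contra hkj
        exact O.notMem_edgeLine_of_mem_of_mem hji.symm hki.symm (Ne.symm hkj) hp hj hk
      rw [cross_smul_right, cross_add_right, cross_self_eq_zero, cross_swap (O.edgeDir i)]
      linarith
  · exact ⟨O.edgeDir (i + 1), O.cross_edgeDir_succ_pos i, fun j hji hj => absurd ⟨j, hji, hj⟩ h⟩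

lemma eventually_add_smul_mem_halfPlane {m : Plane} (hp : p ∈ O.halfPlane j)
    (hm : p ∈ O.edgeLine j → cross (O.edgeDir j) m ≤ 0) :
    ∀ᶠ ε : ℝ in nhdsWithin 0 (Ioi 0), p + ε • m ∈ O.halfPlane j := by
  rcases (O.mem_halfPlane.1 hp).lt_or_eq with hlt | heq
  · have hc : Continuous fun ε : ℝ => O.side j (p + ε • m) :=
      (O.continuous_side j).comp (by fun_prop)
    have hlim := hc.tendsto' 0 (O.side j p) (by simp)
    filter_upwards [(hlim.eventually (gt_mem_nhds hlt)).filter_mono nhdsWithin_le_nhds] with ε hε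
    exact hε.le
  · filter_upwards [self_mem_nhdsWithin] with ε hε
    rw [mem_halfPlane, O.side_add_smul heq]
    exact mul_nonpos_of_nonneg_of_nonpos (le_of_lt hε) (hm heq)

end ConvexPolygon

/-! ### Symmetric bends -/

section Bends

variable {E : Type*} [NormedAddCommGroup E] [InnerProductSpace ℝ E]

open NormedSpace InnerProductGeometry

lemma inner_normalize_left (u d : E) :
    inner ℝ (normalize u) d = Real.cos (angle u d) * ‖d‖ := by
  rcases eq_or_ne u 0 with rfl | hu
  · simp
  · rw [NormedSpace.normalize, real_inner_smul_left, ← cos_angle_mul_norm_mul_norm]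
    field_simp [norm_ne_zero_iff.2 hu]

lemma inner_normalize_add_normalize_eq_zero {u w d : E} (h : angle u d = angle w (-d)) :
    inner ℝ (normalize u + normalize w) d = 0 := by
  rw [inner_add_left, inner_normalize_left, h, ← norm_neg d, ← inner_normalize_left,
    inner_neg_right, neg_add_cancel]

lemma eventually_dist_add_dist_lt {u w p m : E} (h : dist u p = dist w p)
    (hm : 0 < inner ℝ (u - p + (w - p)) m) :
    ∀ᶠ ε : ℝ in nhdsWithin 0 (Ioi 0),
      dist u (p + ε • m) + dist (p + ε • m) w < dist u p + dist p w := by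
  have hc : Continuous fun ε : ℝ => ε * ‖m‖ ^ 2 := by fun_prop
  have hlim := (hc.tendsto' 0 0 (zero_mul _)).mono_left (nhdsWithin_le_nhds (s := Ioi 0))
  filter_upwards [hlim.eventually (gt_mem_nhds hm), self_mem_nhdsWithin] with ε hε (hpos : 0 < ε)
  have hsq (z : E) :
      dist z (p + ε • m) ^ 2 = dist z p ^ 2 - 2 * (ε * inner ℝ (z - p) m) + ε ^ 2 * ‖m‖ ^ 2 := by
    rw [dist_eq_norm, ← sub_sub, norm_sub_sq_real, inner_smul_right, norm_smul,
      Real.norm_of_nonneg hpos.le, dist_eq_norm, mul_pow]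
  have hu := hsq u
  have hw := hsq w
  rw [inner_add_left] at hε
  rw [dist_comm _ w, dist_comm p w]
  rw [← h] at hw ⊢
  have hlt := mul_lt_mul_of_pos_left hε hpos
  refine lt_of_pow_lt_pow_left₀ 2 (by positivity) ?_
  nlinarith [sq_nonneg (dist u (p + ε • m) - dist w (p + ε • m))]

lemma lineMap_eq_add_dist_smul_normalize (A B : E) {c : ℝ} (hc : 0 ≤ c) :
    AffineMap.lineMap A B c = A + dist (AffineMap.lineMap A B c) A • normalize (B - A) := by
  rw [dist_lineMap_left, Real.norm_of_nonneg hc, dist_comm, dist_eq_norm, mul_smul,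
    norm_smul_normalize, AffineMap.lineMap_apply, vsub_eq_sub, vadd_eq_add, add_comm]

end Bends

/-! ### Reflections -/

open NormedSpace (normalize)

namespace RunsStraight

variable {f : ℝ → Plane} {a b r : ℝ}

lemma eq_add_dist_left_smul (h : RunsStraight f a b) (hr : r ∈ Icc a b) :
    f r = f a + dist (f r) (f a) • normalize (f b - f a) := by
  obtain ⟨φ, hmono, h0, -, hφ⟩ := h
  have hnonneg : 0 ≤ φ r := h0 ▸ hmono (left_mem_Icc.2 (hr.1.trans hr.2)) hr hr.1
  rw [hφ r hr]
  exact lineMap_eq_add_dist_smul_normalize _ _ hnonneg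

lemma eq_add_dist_right_smul (h : RunsStraight f a b) (hr : r ∈ Icc a b) :
    f r = f b + dist (f r) (f b) • normalize (f a - f b) := by
  obtain ⟨φ, hmono, -, h1, hφ⟩ := h
  have hnonneg : 0 ≤ 1 - φ r :=
    sub_nonneg.2 (h1 ▸ hmono hr (right_mem_Icc.2 (hr.1.trans hr.2)) hr.2)
  rw [hφ r hr, ← AffineMap.lineMap_apply_one_sub]
  exact lineMap_eq_add_dist_smul_normalize _ _ hnonneg

lemma monotoneOn_dist_left (h : RunsStraight f a b) :
    MonotoneOn (fun r => dist (f r) (f a)) (Icc a b) := by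
  obtain ⟨φ, hmono, h0, -, hφ⟩ := h
  intro r hr s hs hrs
  have hnonneg : 0 ≤ φ r := h0 ▸ hmono (left_mem_Icc.2 (hr.1.trans hr.2)) hr hr.1
  have hle : φ r ≤ φ s := hmono hr hs hrs
  simp only [hφ r hr, hφ s hs, dist_lineMap_left]
  gcongr ?_ * _
  exact abs_le_abs_of_nonneg hnonneg hle

lemma antitoneOn_dist_right (h : RunsStraight f a b) :
    AntitoneOn (fun r => dist (f r) (f b)) (Icc a b) := by
  obtain ⟨φ, hmono, -, h1, hφ⟩ := h
  intro r hr s hs hrs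
  have hnonneg : 0 ≤ 1 - φ s :=
    sub_nonneg.2 (h1 ▸ hmono hs (right_mem_Icc.2 (hs.1.trans hs.2)) hs.2)
  have hle : 1 - φ s ≤ 1 - φ r := sub_le_sub_left (hmono hr hs hrs) 1
  simp only [hφ r hr, hφ s hs, dist_lineMap_right]
  gcongr ?_ * _
  exact abs_le_abs_of_nonneg hnonneg hle

end RunsStraight

namespace ConvexPolygon

variable {n : ℕ} [NeZero n] {O : ConvexPolygon n} {f : ℝ → Plane} {i j : Fin n}
  {t a b r : ℝ} {x y : Plane}

variable (O) in
/-- The path `f` makes a reflection off `H i` at time `t`, described by the rays from `f t` along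
which it arrives and leaves: `f` stays on the ray of direction `x` during `[a, t]`, approaching
`f t`, and on the ray of direction `y` during `[t, b]`, moving away from `f t` after a possible
rest. -/
structure Reflects (f : ℝ → Plane) (i : Fin n) (t a b : ℝ) (x y : Plane) : Prop where
  nonneg : 0 ≤ a
  lt_time : a < t
  time_lt : t < b
  le_one : b ≤ 1
  mem_edgeLine : f t ∈ O.edgeLine i
  cross_in : 0 < cross (O.edgeDir i) x
  cross_out : 0 < cross (O.edgeDir i) y
  inner_eq : inner ℝ (x + y) (O.edgeDir i) = 0
  in_ray : ∀ r ∈ Icc a t, f r = f t + dist (f r) (f t) • x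
  out_ray : ∀ r ∈ Icc t b, f r = f t + dist (f r) (f t) • y
  in_antitone : AntitoneOn (fun r => dist (f r) (f t)) (Icc a t)
  out_monotone : MonotoneOn (fun r => dist (f r) (f t)) (Icc t b)
  in_ne : ∀ r ∈ Ico a t, f r ≠ f t
  out_ne : f b ≠ f t

lemma cross_normalize_sub_pos {p z : Plane} (hp : p ∈ O.edgeLine i) (hz : z ∉ O.halfPlane i) :
    0 < cross (O.edgeDir i) (normalize (z - p)) := by
  have hne : z ≠ p := fun h => hz (h ▸ O.edgeLine_subset_halfPlane i hp)
  rw [notMem_halfPlane, ← add_sub_cancel p z, side_add, O.mem_edgeLine.1 hp, zero_add] at hz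
  rw [NormedSpace.normalize, cross_smul_right]
  exact mul_pos (inv_pos.2 (norm_pos_iff.2 (sub_ne_zero.2 hne))) hz

lemma IsReflection.exists_reflects (h : O.IsReflection f i t) :
    ∃ a b x y, O.Reflects f i t a b x y := by
  obtain ⟨a, v, b, ha, hat, htv, hvb, hb, hfa, hft, hfb, hin, hne, hrest, hout, hang⟩ := h
  have hv : f v = f t := hrest v (right_mem_Icc.2 htv)
  refine ⟨a, b, normalize (f a - f t), normalize (f b - f t), ha, hat, htv.trans_lt hvb, hb, hft,
    cross_normalize_sub_pos hft hfa, cross_normalize_sub_pos hft hfb,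
    inner_normalize_add_normalize_eq_zero hang, fun r hr => hin.eq_add_dist_right_smul hr,
    fun r hr => ?_, hin.antitoneOn_dist_right, ?_, hne,
    fun hbt => hfb (hbt ▸ O.edgeLine_subset_halfPlane i hft)⟩
  · rcases le_total r v with hrv | hvr
    · rw [hrest r ⟨hr.1, hrv⟩, dist_self, zero_smul, add_zero]
    · exact hv ▸ hout.eq_add_dist_left_smul ⟨hvr, hr.2⟩
  · have hconst : MonotoneOn (fun r => dist (f r) (f t)) (Icc t v) := fun r hr s hs _ => by
      simp only [hrest r hr, hrest s hs, le_refl]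
    rw [← Icc_union_Icc_eq_Icc htv hvb.le]
    exact hconst.union_right (hv ▸ hout.monotoneOn_dist_left) (isGreatest_Icc htv)
      (isLeast_Icc hvb.le)

namespace Reflects

lemma time_mem (h : O.Reflects f i t a b x y) : t ∈ Icc (0 : ℝ) 1 :=
  ⟨h.nonneg.trans h.lt_time.le, h.time_lt.le.trans h.le_one⟩

lemma eq_of_mem_halfPlane (h : O.Reflects f i t a b x y) (hr : r ∈ Icc a b)
    (hi : f r ∈ O.halfPlane i) : f r = f t := by
  obtain ⟨z, hz, hray⟩ :
      ∃ z, 0 < cross (O.edgeDir i) z ∧ f r = f t + dist (f r) (f t) • z := by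
    rcases le_total r t with hrt | htr
    · exact ⟨x, h.cross_in, h.in_ray r ⟨hr.1, hrt⟩⟩
    · exact ⟨y, h.cross_out, h.out_ray r ⟨htr, hr.2⟩⟩
  rw [hray, O.mem_halfPlane, O.side_add_smul h.mem_edgeLine] at hi
  exact dist_le_zero.1 (nonpos_of_mul_nonpos_left hi hz)

lemma exists_window (h : O.Reflects f i t a b x y) (hf : ContinuousOn f (Icc 0 1)) {U : Set Plane}
    (hU : U ∈ nhds (f t)) :
    ∃ a' ∈ Ico a t, ∃ b' ∈ Ioc t b, dist (f a') (f t) = dist (f b') (f t) ∧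
      MapsTo f (Icc a' b') U := by
  obtain ⟨ρ, hρ, hball⟩ := Metric.mem_nhds_iff.1 hU
  have hdist : ContinuousOn (fun r => dist (f r) (f t)) (Icc 0 1) :=
    continuous_dist.comp_continuousOn (hf.prodMk continuousOn_const)
  have hda := dist_pos.2 (h.in_ne a (left_mem_Ico.2 h.lt_time))
  have hdb := dist_pos.2 h.out_ne
  obtain ⟨δ, hδ, hδmin⟩ := exists_between (lt_min (lt_min hda hdb) hρ)
  obtain ⟨⟨hδa, hδb⟩, hδρ⟩ := lt_min_iff.1 hδmin |>.imp_left lt_min_iff.1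
  have hδt : dist (f t) (f t) < δ := by rwa [dist_self]
  obtain ⟨a', ⟨haa', ha't⟩, ha'⟩ := intermediate_value_Ioo' h.lt_time.le
    (hdist.mono (Icc_subset_Icc h.nonneg h.time_mem.2)) ⟨hδt, hδa⟩
  obtain ⟨b', ⟨htb', hb'b⟩, hb'⟩ := intermediate_value_Ioo h.time_lt.le
    (hdist.mono (Icc_subset_Icc h.time_mem.1 h.le_one)) ⟨hδt, hδb⟩
  refine ⟨a', ⟨haa'.le, ha't⟩, b', ⟨htb', hb'b.le⟩, ha'.trans hb'.symm, fun r hr => hball ?_⟩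
  refine lt_of_le_of_lt ?_ hδρ
  rcases le_total r t with hrt | htr
  · exact ha' ▸ h.in_antitone ⟨haa'.le, ha't.le⟩ ⟨haa'.le.trans hr.1, hrt⟩ hr.1
  · exact hb' ▸ h.out_monotone ⟨htr, hr.2.trans hb'b.le⟩ ⟨htb'.le, hb'b.le⟩ hr.2

lemma inner_pos (h : O.Reflects f i t a b x y) {m : Plane} (hm : 0 < cross (O.edgeDir i) m) :
    0 < inner ℝ (x + y) m := by
  have hpos : 0 < cross (O.edgeDir i) (x + y) * cross (O.edgeDir i) m := by
    rw [cross_add_right]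
    exact mul_pos (add_pos h.cross_in h.cross_out) hm
  have hinner := inner_mul_inner_self_eq_add (O.edgeDir i) (x + y) m
  rw [h.inner_eq, zero_mul, add_zero] at hinner
  exact pos_of_mul_pos_left (hinner ▸ hpos) real_inner_self_nonneg

lemma directions_eq {a' b' : ℝ} {x' y' : Plane} (h : O.Reflects f i t a b x y)
    (h' : O.Reflects f j t a' b' x' y') : x = x' ∧ y = y' := by
  constructor
  · have hmem : max a a' < t := max_lt h.lt_time h'.lt_time
    refine smul_right_injective _ (dist_ne_zero.2 (h.in_ne _ ⟨le_max_left a a', hmem⟩))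
      (add_left_cancel (a := f t) ?_)
    exact (h.in_ray _ ⟨le_max_left .., hmem.le⟩).symm.trans
      (h'.in_ray _ ⟨le_max_right .., hmem.le⟩)
  · obtain ⟨r, hr, hr', hne⟩ : ∃ r, r ∈ Icc t b ∧ r ∈ Icc t b' ∧ f r ≠ f t := by
      rcases le_total b b' with hbb' | hb'b
      · exact ⟨b, ⟨h.time_lt.le, le_rfl⟩, ⟨h.time_lt.le, hbb'⟩, h.out_ne⟩
      · exact ⟨b', ⟨h'.time_lt.le, hb'b⟩, ⟨h'.time_lt.le, le_rfl⟩, h'.out_ne⟩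
    exact smul_right_injective _ (dist_ne_zero.2 hne)
      (add_left_cancel ((h.out_ray r hr).symm.trans (h'.out_ray r hr')))

lemma index_eq {a' b' : ℝ} {x' y' : Plane} (h : O.Reflects f i t a b x y)
    (h' : O.Reflects f j t a' b' x' y') : i = j := by
  obtain ⟨rfl, rfl⟩ := h.directions_eq h'
  by_contra hij
  have hsum : x + y = 0 := eq_zero_of_inner_eq_zero
    (O.cross_edgeDir_ne_zero hij h.mem_edgeLine h'.mem_edgeLine) h.inner_eq h'.inner_eq
  have hpos := add_pos h.cross_in h.cross_out
  rw [← cross_add_right, hsum] at hpos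
  simp [cross] at hpos

lemma exists_ne_mem_halfPlane (h : O.Reflects f i t a b x y) (hf : O.IsPath f) :
    ∃ j ≠ i, f t ∈ O.halfPlane j := by
  obtain ⟨a', ha', b', hb', -, hU⟩ := h.exists_window hf.1 (O.openStar_mem_nhds (f t))
  obtain ⟨j, hj⟩ := O.mem_freeSpace.1
    (hf.2 ⟨h.nonneg.trans ha'.1, ha'.2.le.trans h.time_mem.2⟩ : f a' ∈ O.freeSpace)
  refine ⟨j, ?_, mem_halfPlane_of_mem_openStar (hU ⟨le_rfl, ha'.2.le.trans hb'.1.le⟩) hj⟩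
  rintro rfl
  exact h.in_ne a' ha' (h.eq_of_mem_halfPlane ⟨ha'.1, ha'.2.le.trans h.time_lt.le⟩ hj)

lemma exists_shortcut_point (h : O.Reflects f i t a b x y) (hf : O.IsPath f) :
    ∃ a' ∈ Ico a t, ∃ b' ∈ Ioc t b, ∃ q, segment ℝ (f a') q ⊆ O.freeSpace ∧
      segment ℝ q (f b') ⊆ O.freeSpace ∧
      dist (f a') q + dist q (f b') < dist (f a') (f t) + dist (f t) (f b') ∧
      ∀ k ≠ i, ∀ r ∈ Icc a' b', f r ∈ O.halfPlane k → q ∈ O.halfPlane k := by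
  obtain ⟨a', ha', b', hb', hdist, hU⟩ := h.exists_window hf.1 (O.openStar_mem_nhds (f t))
  have ha'b' : a' ≤ b' := ha'.2.le.trans hb'.1.le
  have hne : f a' ≠ f t := h.in_ne a' ha'
  have hne' : f b' ≠ f t := dist_ne_zero.1 (hdist ▸ dist_ne_zero.2 hne)
  have hai : f a' ∉ O.halfPlane i :=
    mt (h.eq_of_mem_halfPlane ⟨ha'.1, ha'b'.trans hb'.2⟩) hne
  have hbi : f b' ∉ O.halfPlane i :=
    mt (h.eq_of_mem_halfPlane ⟨ha'.1.trans ha'b', hb'.2⟩) hne'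
  obtain ⟨j, hji, hpj, haj, hbj⟩ := O.exists_common_halfPlane h.mem_edgeLine
    ⟨hU (left_mem_Icc.2 ha'b'), hf.2 ⟨h.nonneg.trans ha'.1, ha'.2.le.trans h.time_mem.2⟩⟩
    ⟨hU (right_mem_Icc.2 ha'b'), hf.2 ⟨h.time_mem.1.trans hb'.1.le, hb'.2.trans h.le_one⟩⟩ hai hbi
  obtain ⟨m, hmi, hm⟩ := O.exists_cross_pos_and_cross_neg h.mem_edgeLine
  have hinner : 0 < inner ℝ (f a' - f t + (f b' - f t)) m := by
    have hx := sub_eq_iff_eq_add'.2 (h.in_ray a' ⟨ha'.1, ha'.2.le⟩)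
    have hy := sub_eq_iff_eq_add'.2 (h.out_ray b' ⟨hb'.1.le, hb'.2⟩)
    rw [hx, hy, ← hdist, ← smul_add, real_inner_smul_left]
    exact mul_pos (dist_pos.2 hne) (h.inner_pos hmi)
  have hstay : ∀ᶠ ε : ℝ in nhdsWithin 0 (Ioi 0), ∀ k, k ≠ i → f t ∈ O.halfPlane k →
      f t + ε • m ∈ O.halfPlane k := by
    simp only [Filter.eventually_all]
    exact fun k hki hk => O.eventually_add_smul_mem_halfPlane hk fun hk' => (hm k hki hk').le
  obtain ⟨ε, hlt, hε⟩ := ((eventually_dist_add_dist_lt hdist hinner).and hstay).exists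
  exact ⟨a', ha', b', hb', f t + ε • m, O.segment_subset_freeSpace haj (hε j hji hpj),
    O.segment_subset_freeSpace (hε j hji hpj) hbj, hlt,
    fun k hki r hr hk => hε k hki (mem_halfPlane_of_mem_openStar (hU hr) hk)⟩

end Reflects

/-! ### Shortening a route -/

variable (O) in
/-- Some watchman route with the same starting point is strictly shorter than `f`. -/
def Shortenable (f : ℝ → Plane) : Prop :=
  ∃ g : ℝ → Plane, O.IsWatchmanRoute g ∧ g 0 = f 0 ∧ pathLength g < pathLength f

lemma Reflects.shortenable_of_mem_halfPlane {τ : ℝ} (h : O.Reflects f i t a b x y)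
    (hf : O.IsWatchmanRoute f) (hfin : pathLength f ≠ ⊤) (hτ : τ ∈ Icc (0 : ℝ) 1)
    (hτab : τ ∉ Icc a b) (hτi : f τ ∈ O.halfPlane i) : O.Shortenable f := by
  obtain ⟨hpath, hvisit⟩ := O.isWatchmanRoute_iff.1 hf
  obtain ⟨a', ha', b', hb', q, haq, hqb, hlt, hq⟩ := h.exists_shortcut_point hpath
  have ha'0 := h.nonneg.trans ha'.1
  obtain ⟨g, hg, hgf, ⟨u, hu, hgu⟩, hlen⟩ := IsPathIn.exists_shortcut hpath hfin ha'0 ha'.2 hb'.1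
    (hb'.2.trans h.le_one) haq hqb hlt
  refine ⟨g, O.isWatchmanRoute_iff.2 ⟨hg, fun k => ?_⟩, hgf 0 fun h0 => ha'0.not_gt h0.1, hlen⟩
  rcases eq_or_ne k i with rfl | hki
  · have hτ' : τ ∉ Ioo a' b' := fun hcon =>
      hτab ⟨ha'.1.trans hcon.1.le, hcon.2.le.trans hb'.2⟩
    exact ⟨τ, hτ, hgf τ hτ' ▸ hτi⟩
  · obtain ⟨r, hr, hrk⟩ := hvisit k
    by_cases hr' : r ∈ Ioo a' b'
    · exact ⟨u, hu, hgu ▸ hq k hki r (Ioo_subset_Icc_self hr') hrk⟩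
    · exact ⟨r, hr, hgf r hr' ▸ hrk⟩

variable (O) in
lemma isWatchmanRoute_comp_mul {T : ℝ} (hT : 0 ≤ T) (hf : IsPathIn O.freeSpace 0 T f)
    (hvisit : ∀ i, ∃ r ∈ Icc 0 T, f r ∈ O.halfPlane i) :
    O.IsWatchmanRoute fun u => f (T * u) := by
  refine O.isWatchmanRoute_iff.2 ⟨hf.comp_mul hT, fun i => ?_⟩
  obtain ⟨r, hr, hri⟩ := hvisit i
  rw [← image_mul_Icc_zero_one hT] at hr
  obtain ⟨u, hu, rfl⟩ := hr
  exact ⟨u, hu, hri⟩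

variable (O) in
lemma exists_isWatchmanRoute_pathLength_ne_top {s : Plane} (hs : s ∈ O.freeSpace) :
    ∃ g : ℝ → Plane, O.IsWatchmanRoute g ∧ g 0 = s ∧ pathLength g ≠ ⊤ := by
  obtain ⟨i, hi⟩ := O.mem_freeSpace.1 hs
  let v : ℕ → Plane
    | 0 => s
    | m + 1 => O.vertex (i + Fin.ofNat n m)
  have hv : ∀ k ≤ n, segment ℝ (v k) (v (k + 1)) ⊆ O.freeSpace := by
    rintro (_ | m) -
    · have h0 : v 1 = O.vertex i := by simp [v]
      rw [h0]
      exact O.segment_subset_freeSpace hi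
        (O.edgeLine_subset_halfPlane i (O.vertex_mem_edgeLine i))
    · have hsucc : i + Fin.ofNat n (m + 1) = i + Fin.ofNat n m + 1 := by
        ext
        simp [Fin.val_add, add_assoc]
      change segment ℝ (O.vertex _) (O.vertex (i + Fin.ofNat n (m + 1))) ⊆ _
      rw [hsucc]
      exact O.segment_subset_freeSpace
        (O.edgeLine_subset_halfPlane _ (O.vertex_mem_edgeLine _))
        (O.edgeLine_subset_halfPlane _ (O.vertex_succ_mem_edgeLine _))
  obtain ⟨g, hg, hfin, hgv⟩ := exists_isPathIn_polygonal v n hv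
  refine ⟨fun u => g (n * u), O.isWatchmanRoute_comp_mul n.cast_nonneg hg fun j => ?_, ?_, ?_⟩
  · have hlt : (j - i).val + 1 ≤ n := (j - i).isLt
    refine ⟨((j - i).val + 1 : ℕ), ⟨Nat.cast_nonneg _, by exact_mod_cast hlt⟩, ?_⟩
    have hvj : v ((j - i).val + 1) = O.vertex j := by simp [v]
    rw [hgv _ hlt, hvj]
    exact O.edgeLine_subset_halfPlane j (O.vertex_mem_edgeLine j)
  · simpa using hgv 0 n.zero_le
  · rwa [pathLength, eVariationOn_comp_mul g n.cast_nonneg]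

lemma shortenable_of_pathLength_eq_top (hf : O.IsPath f) (hlen : pathLength f = ⊤) :
    O.Shortenable f := by
  obtain ⟨g, hg, hg0, hfin⟩ :=
    O.exists_isWatchmanRoute_pathLength_ne_top (hf.2 (left_mem_Icc.2 zero_le_one))
  exact ⟨g, hg, hg0, hlen ▸ hfin.lt_top⟩

lemma shortenable_of_forall_exists_mem_halfPlane (hf : O.IsPath f) (hfin : pathLength f ≠ ⊤)
    (ht : 0 ≤ t) (htr : t ≤ r) (hr : r ≤ 1) (hne : f t ≠ f r)
    (hvisit : ∀ k, ∃ u ∈ Icc 0 t, f u ∈ O.halfPlane k) : O.Shortenable f := by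
  have ht1 := htr.trans hr
  refine ⟨fun u => f (t * u),
    O.isWatchmanRoute_comp_mul ht (IsPathIn.mono hf le_rfl ht1) hvisit, by simp, ?_⟩
  have hpos : 0 < eVariationOn f (Icc t 1) := (edist_pos.2 hne).trans_le
    (eVariationOn.edist_le f (left_mem_Icc.2 ht1) ⟨htr, hr⟩)
  have hfin' : eVariationOn f (Icc 0 t) ≠ ⊤ :=
    ne_top_of_le_ne_top hfin (eVariationOn.mono f (Icc_subset_Icc_right ht1))
  rw [pathLength, eVariationOn_comp_mul f ht, pathLength, ← eVariationOn_Icc_add_Icc f ht ht1]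
  exact ENNReal.lt_add_right hfin' hpos.ne'

end ConvexPolygon

/-! ### Chords between edges -/

open SignType (sign)

lemma sign_eq_sign_of_isPreconnected {X : Type*} [TopologicalSpace X] {S : Set X} {F : X → ℝ}
    (hS : IsPreconnected S) (hF : ContinuousOn F S) (h0 : ∀ z ∈ S, F z ≠ 0) {x y : X}
    (hx : x ∈ S) (hy : y ∈ S) : sign (F x) = sign (F y) :=
  hS.constant
    (fun z hz => (continuousAt_sign_of_ne_zero (h0 z hz)).comp_continuousWithinAt (hF z hz)) hx hy

namespace ConvexPolygon

variable {n : ℕ} [NeZero n] (O : ConvexPolygon n) {i j k : Fin n} {p z : Plane}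

/-- The affine function that vanishes on the line through the midpoints of edges `i` and `j` and is
positive to the left of it. Between the two midpoints this line runs inside the obstacle. -/
noncomputable def chord (i j : Fin n) : Plane →ᵃ[ℝ] ℝ := orient (O.edgeMid i) (O.edgeMid j)

lemma continuous_chord (i j : Fin n) : Continuous (O.chord i j) := continuous_orient _ _

lemma chord_swap (i j : Fin n) (z : Plane) : O.chord j i z = -O.chord i j z := orient_swap _ _ _

lemma chord_edgeMid_swap (i j k : Fin n) :
    O.chord i k (O.edgeMid j) = -O.chord i j (O.edgeMid k) := orient_swap_right _ _ _

lemma sign_chord_edgeMid_add_smul (hij : i ≠ j) (c : ℝ) :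
    sign (O.chord i j (O.edgeMid i + c • O.edgeDir i)) = sign (-c) := by
  have hside : cross (O.edgeDir i) (O.edgeMid j - O.edgeMid i) = O.side i (O.edgeMid j) := by
    rw [← add_sub_cancel (O.edgeMid i) (O.edgeMid j), side_add, add_sub_cancel,
      O.mem_edgeLine.1 (O.edgeMid_mem_edgeLine i), zero_add]
  have hchord : O.chord i j (O.edgeMid i + c • O.edgeDir i) = -c * O.side i (O.edgeMid j) := by
    rw [chord, orient_add, orient_left, cross_smul_right, cross_swap (O.edgeDir i), hside]
    ring
  rw [hchord, sign_mul, sign_pos (O.side_edgeMid_pos hij.symm), mul_one]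

lemma chord_ne_zero (hij : i ≠ j) (hp : p ∈ O.edgeLine i) (hne : p ≠ O.edgeMid i) :
    O.chord i j p ≠ 0 := by
  obtain ⟨c, rfl⟩ := O.exists_eq_edgeMid_add_smul hp
  have hc : c ≠ 0 := fun h0 => hne (by rw [h0, zero_smul, add_zero])
  rw [← sign_ne_zero, O.sign_chord_edgeMid_add_smul hij, sign_ne_zero]
  exact neg_ne_zero.2 hc

lemma sign_chord_eq_of_mem_edgeLine (hij : i ≠ j) (hik : i ≠ k) (hp : p ∈ O.edgeLine i) :
    sign (O.chord i j p) = sign (O.chord i k p) := by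
  obtain ⟨c, rfl⟩ := O.exists_eq_edgeMid_add_smul hp
  rw [O.sign_chord_edgeMid_add_smul hij, O.sign_chord_edgeMid_add_smul hik]

variable {O}

lemma mem_halfPlane_or_of_chord_eq_zero (hij : i ≠ j) (hz : z ∈ O.freeSpace)
    (h0 : O.chord i j z = 0) : z ∈ O.halfPlane i ∨ z ∈ O.halfPlane j := by
  by_contra! ⟨hi, hj⟩
  obtain ⟨k, hk⟩ := O.mem_freeSpace.1 hz
  have hik : i ≠ k := fun h => hi (h ▸ hk)
  have hjk : j ≠ k := fun h => hj (h ▸ hk)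
  obtain ⟨c, rfl⟩ := exists_eq_lineMap_of_orient_eq_zero (O.edgeMid_injective.ne hij) h0
  rw [notMem_halfPlane] at hi hj
  rw [mem_halfPlane] at hk
  rw [AffineMap.apply_lineMap, AffineMap.lineMap_apply_ring] at hi hj hk
  rw [O.mem_edgeLine.1 (O.edgeMid_mem_edgeLine _), mul_zero, zero_add] at hi
  rw [O.mem_edgeLine.1 (O.edgeMid_mem_edgeLine _), mul_zero, add_zero] at hj
  have hc : 0 < c := pos_of_mul_pos_left hi (O.side_edgeMid_pos hij.symm).le
  have hc' : 0 < 1 - c := pos_of_mul_pos_left hj (O.side_edgeMid_pos hij).le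
  exact hk.not_gt
    (add_pos (mul_pos hc' (O.side_edgeMid_pos hik)) (mul_pos hc (O.side_edgeMid_pos hjk)))

lemma sign_chord_eq_sign_chord_edgeMid (hij : i ≠ j) (hik : i ≠ k) (hjk : j ≠ k)
    (hk : z ∈ O.halfPlane k) (hi : 0 ≤ O.side i z) (hj : 0 ≤ O.side j z)
    (h0 : O.chord i j z ≠ 0) : sign (O.chord i j z) = sign (O.chord i j (O.edgeMid k)) := by
  refine sign_eq_sign_of_isPreconnected (convex_segment z (O.edgeMid k)).isPreconnected
    (O.continuous_chord i j).continuousOn (fun w hw hw0 => ?_) (left_mem_segment ..)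
    (right_mem_segment ..)
  have hw' : w ∈ O.freeSpace := O.segment_subset_freeSpace hk
    (O.edgeLine_subset_halfPlane k (O.edgeMid_mem_edgeLine k)) hw
  rw [segment_eq_image_lineMap] at hw
  obtain ⟨c, hc, rfl⟩ := hw
  rcases hc.1.eq_or_lt with rfl | hpos
  · exact h0 (by rwa [AffineMap.lineMap_apply_zero] at hw0)
  have hoff : ∀ {l}, l ≠ k → 0 ≤ O.side l z →
      AffineMap.lineMap z (O.edgeMid k) c ∉ O.halfPlane l := fun hlk hl => by
    rw [notMem_halfPlane, AffineMap.apply_lineMap, AffineMap.lineMap_apply_ring]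
    exact add_pos_of_nonneg_of_pos (mul_nonneg (sub_nonneg.2 hc.2) hl)
      (mul_pos hpos (O.side_edgeMid_pos hlk.symm))
  exact (mem_halfPlane_or_of_chord_eq_zero hij hw' hw0).elim (hoff hik hi) (hoff hjk hj)

variable {f : ℝ → Plane} {q : Plane} {t t' r : ℝ}

variable (O) in
/-- Whenever the path `f` is in `H i` it is at the point `p` of the boundary line, which is not the
midpoint of edge `i`. -/
structure TouchesOnlyAt (f : ℝ → Plane) (i : Fin n) (p : Plane) : Prop where
  mem_edgeLine : p ∈ O.edgeLine i
  ne_edgeMid : p ≠ O.edgeMid i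
  eq_of_mem : ∀ r ∈ Icc (0 : ℝ) 1, f r ∈ O.halfPlane i → f r = p

namespace TouchesOnlyAt

lemma side_nonneg (h : O.TouchesOnlyAt f i p) (hr : r ∈ Icc (0 : ℝ) 1) : 0 ≤ O.side i (f r) := by
  by_contra! hneg
  rw [h.eq_of_mem r hr hneg.le, O.mem_edgeLine.1 h.mem_edgeLine] at hneg
  exact lt_irrefl _ hneg

lemma chord_ne_zero_of_mem (h : O.TouchesOnlyAt f i p) (hij : i ≠ j) (hr : r ∈ Icc (0 : ℝ) 1)
    (hi : f r ∈ O.halfPlane i) : O.chord i j (f r) ≠ 0 := by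
  rw [h.eq_of_mem r hr hi]
  exact O.chord_ne_zero hij h.mem_edgeLine h.ne_edgeMid

lemma chord_ne_zero (hi : O.TouchesOnlyAt f i p) (hj : O.TouchesOnlyAt f j q) (hij : i ≠ j)
    (hr : r ∈ Icc (0 : ℝ) 1) (hfr : f r ∈ O.freeSpace) : O.chord i j (f r) ≠ 0 := fun h0 => by
  rcases mem_halfPlane_or_of_chord_eq_zero hij hfr h0 with hri | hrj
  · exact hi.chord_ne_zero_of_mem hij hr hri h0
  · exact hj.chord_ne_zero_of_mem hij.symm hr hrj (by rw [chord_swap, h0, neg_zero])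

lemma exists_visit_before (hi : O.TouchesOnlyAt f i (f t)) (hj : O.TouchesOnlyAt f j (f t'))
    (hf : O.IsPath f) (hij : i ≠ j) (ht : 0 ≤ t) (htt' : t ≤ t') (ht' : t' ≤ 1)
    (hk : ∃ τ ∈ Icc (0 : ℝ) 1, f τ ∈ O.halfPlane k) :
    ∃ r ∈ Icc 0 t', f r ∈ O.halfPlane k := by
  by_contra! hnot
  obtain ⟨τ, hτ, hτk⟩ := hk
  have hsub : Icc 0 t' ⊆ Icc (0 : ℝ) 1 := Icc_subset_Icc_right ht'
  have htmem : t ∈ Icc 0 t' := ⟨ht, htt'⟩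
  have ht'mem : t' ∈ Icc 0 t' := right_mem_Icc.2 (ht.trans htt')
  have hik : i ≠ k := by
    rintro rfl
    exact hnot t htmem (O.edgeLine_subset_halfPlane i hi.mem_edgeLine)
  have hjk : j ≠ k := by
    rintro rfl
    exact hnot t' ht'mem (O.edgeLine_subset_halfPlane j hj.mem_edgeLine)
  have hchord_ij : ∀ r ∈ Icc (0 : ℝ) 1, O.chord i j (f r) ≠ 0 := fun r hr =>
    hi.chord_ne_zero hj hij hr (hf.2 hr)
  have hchord_ik : ∀ r ∈ Icc 0 t', O.chord i k (f r) ≠ 0 := fun r hr h0 =>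
    (mem_halfPlane_or_of_chord_eq_zero hik (hf.2 (hsub hr)) h0).elim
      (fun hri => hi.chord_ne_zero_of_mem hik (hsub hr) hri h0) (hnot r hr)
  have hτsign : sign (O.chord i j (f τ)) = sign (O.chord i j (O.edgeMid k)) :=
    sign_chord_eq_sign_chord_edgeMid hij hik hjk hτk (hi.side_nonneg hτ) (hj.side_nonneg hτ)
      (hchord_ij τ hτ)
  have hsign : sign (O.chord i j (f τ)) = -sign (O.chord i j (f τ)) := calc
    _ = sign (O.chord i j (f t)) := sign_eq_sign_of_isPreconnected isPreconnected_Icc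
      ((O.continuous_chord i j).comp_continuousOn hf.1) hchord_ij hτ (hsub htmem)
    _ = sign (O.chord i k (f t)) := O.sign_chord_eq_of_mem_edgeLine hij hik hi.mem_edgeLine
    _ = sign (O.chord i k (f t')) := sign_eq_sign_of_isPreconnected isPreconnected_Icc
      ((O.continuous_chord i k).comp_continuousOn (hf.1.mono hsub)) hchord_ik htmem ht'mem
    _ = sign (O.chord i k (O.edgeMid j)) := sign_chord_eq_sign_chord_edgeMid hik hij hjk.symm
      (O.edgeLine_subset_halfPlane j hj.mem_edgeLine) (hi.side_nonneg (hsub ht'mem))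
      (O.notMem_halfPlane.1 (hnot t' ht'mem)).le (hchord_ik t' ht'mem)
    _ = -sign (O.chord i j (O.edgeMid k)) := by rw [chord_edgeMid_swap, Left.sign_neg]
    _ = -sign (O.chord i j (f τ)) := by rw [hτsign]
  rw [SignType.self_eq_neg_iff, sign_eq_zero_iff] at hsign
  exact hchord_ij τ hτ hsign

end TouchesOnlyAt

variable {a b a' b' : ℝ} {x y x' y' : Plane}

namespace Reflects

lemma touchesOnlyAt (h : O.Reflects f i t a b x y) (hf : O.IsWatchmanRoute f)
    (hfin : pathLength f ≠ ⊤) (hns : ¬O.Shortenable f) : O.TouchesOnlyAt f i (f t) where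
  mem_edgeLine := h.mem_edgeLine
  ne_edgeMid hmid := by
    obtain ⟨j, hji, hj⟩ := h.exists_ne_mem_halfPlane hf.1
    exact O.notMem_halfPlane.2 (O.side_edgeMid_pos hji.symm) (hmid ▸ hj)
  eq_of_mem r hr hri := by
    by_cases hrab : r ∈ Icc a b
    · exact h.eq_of_mem_halfPlane hrab hri
    · exact absurd (h.shortenable_of_mem_halfPlane hf hfin hr hrab hri) hns

lemma shortenable_of_lt (h : O.Reflects f i t a b x y) (h' : O.Reflects f j t' a' b' x' y')
    (hf : O.IsWatchmanRoute f) (htt' : t < t') : O.Shortenable f := by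
  by_contra hns
  have hfin : pathLength f ≠ ⊤ := mt (shortenable_of_pathLength_eq_top hf.1) hns
  have hi := h.touchesOnlyAt hf hfin hns
  have hj := h'.touchesOnlyAt hf hfin hns
  have hij : i ≠ j := by
    rintro rfl
    have hti : f t ∈ O.halfPlane i := O.edgeLine_subset_halfPlane i h.mem_edgeLine
    by_cases htab : t ∈ Icc a' b'
    · exact h'.in_ne t ⟨htab.1, htt'⟩ (h'.eq_of_mem_halfPlane htab hti)
    · exact hns (h'.shortenable_of_mem_halfPlane hf hfin h.time_mem htab hti)
  refine hns (shortenable_of_forall_exists_mem_halfPlane hf.1 hfin h'.time_mem.1 h'.time_lt.le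
    h'.le_one h'.out_ne.symm fun k => ?_)
  exact hi.exists_visit_before hj hf.1 hij h.time_mem.1 htt'.le h'.time_mem.2
    ((O.isWatchmanRoute_iff.1 hf).2 k)

end Reflects

lemma reflections_subsingleton (hf : O.IsWatchmanRoute f) (hns : ¬O.Shortenable f) :
    (O.reflections f).Subsingleton := by
  rintro ⟨i, t⟩ hit ⟨j, t'⟩ hjt'
  obtain ⟨a, b, x, y, h⟩ := IsReflection.exists_reflects hit
  obtain ⟨a', b', x', y', h'⟩ := IsReflection.exists_reflects hjt'
  rcases lt_trichotomy t t' with htt' | rfl | htt'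
  · exact absurd (h.shortenable_of_lt h' hf htt') hns
  · exact congrArg (·, t) (h.index_eq h')
  · exact absurd (h'.shortenable_of_lt h hf htt') hns

end ConvexPolygon

theorem mainTheorem8 (n : ℕ) [NeZero n] (O : ConvexPolygon n) (s : Plane)
    (hs : s ∈ O.freeSpace) :
    (∀ f : ℝ → Plane, O.IsOptimalWatchmanRoute s f → (O.reflections f).encard ≤ 1) ∧
    (∀ f : ℝ → Plane, O.IsWatchmanRoute f → f 0 = s → 2 ≤ (O.reflections f).encard →
      ∃ g : ℝ → Plane, O.IsWatchmanRoute g ∧ g 0 = s ∧ pathLength g < pathLength f) := by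
  have key : ∀ f, O.IsWatchmanRoute f → ¬O.Shortenable f → (O.reflections f).encard ≤ 1 :=
    fun f hf hns => encard_le_one_iff_subsingleton.2 (ConvexPolygon.reflections_subsingleton hf hns)
  constructor
  · rintro f ⟨hf, rfl, hopt⟩
    exact key f hf fun ⟨g, hg, hg0, hlt⟩ => (hopt g hg hg0).not_gt hlt
  · rintro f hf rfl htwo
    by_contra hns
    exact absurd (htwo.trans (key f hf hns)) (by norm_num)
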